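/- Notation. For $x\in[0,1]$ let $h(x)=-x\log x$ (natural logarithm, $h(0)=0$) and $H(x)=h(x)+h(1-x)$, and for $x,t\in[0,1]$ with $(2-t)x\le 1$ let $$F(x,t)=\tfrac12 h(tx)+h\big((1-t)x\big)+\tfrac12 h\big(1-(2-t)x\big)-H(x).$$ For positive integers $N,d$ with $Nd$ even, the configuration model $\mathbb{G}_{N,d}$ is the random $d$-regular multigraph (loops and multiple edges allowed) on $\{1,\dots,N\}$ obtained by giving each vertex $d$ half-edges and choosing a uniformly random perfect matching of the $Nd$ half-edges, each matched pair forming one edge. A $k$-star centered at a vertex $v$ is a set of $k$ edges, each incident with $v$ (a loop at $v$ counts as one edge incident with $v$); a $k$-star decomposition is a partition of the edge set into $k$-stars, each with a designated center. Theorem. Let $k\ge 2$, $s\ge 1$ and $0\le r<2k$ be integers and let $d=2sk+r$. Put $$x_0=\frac{r}{2k},\qquad t_0=\frac{d-2k+r}{d},$$ and suppose that $$d\cdot F(x_0,t_0)+H(x_0)<0 .$$ Then, as $N\to\infty$ through the integers with $Nd/(2k)\in\mathbb{N}$, the probability that $\mathbb{G}_{N,d}$ has the following property converges to $1$: for every partition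 $A_s\sqcup A_{s+1}=\{1,\dots,N\}$ with $|A_{s+1}|=rN/(2k)$ there exists a $k$-star decomposition of $\mathbb{G}_{N,d}$ with exactly $j$ stars centered at each vertex of $A_j$ ($j=s,s+1$). -/

import Mathlib

open Filter Topology

/-- A pairing of the `N * d` half-edges; the half-edge `(v, i)` is the `i`-th half-edge at the
vertex `v`. A pairing is given as the involution without fixed points that sends every half-edge
to its partner. -/
def Pairing (N d : ℕ) : Type :=
  {σ : Equiv.Perm (Fin N × Fin d) // ∀ h, σ (σ h) = h ∧ σ h ≠ h}

/-- The `d`-regular multigraph on the vertex set `Fin N` produced by a pairing: each pair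
`{h, σ h}` of half-edges is one edge, joining the two vertices at which `h` and `σ h` sit.
Loops and multiple edges are allowed. -/
def configGraph {N d : ℕ} (σ : Pairing N d) : Graph (Fin N) (Sym2 (Fin N × Fin d)) where
  vertexSet := Set.univ
  IsLink e u v := ∃ h, e = s(h, σ.1 h) ∧ h.1 = u ∧ (σ.1 h).1 = v
  isLink_symm := by
    rintro e -
    refine ⟨?_⟩
    rintro u v ⟨h, rfl, rfl, rfl⟩
    exact ⟨σ.1 h, by rw [(σ.2 h).1, Sym2.eq_swap], rfl, by rw [(σ.2 h).1]⟩
  eq_or_eq_of_isLink_of_isLink := by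
    rintro e x y v w ⟨h, rfl, rfl, rfl⟩ ⟨h', he, rfl, rfl⟩
    rcases Sym2.eq_iff.1 he with ⟨h1, -⟩ | ⟨h1, -⟩
    · exact Or.inl (by rw [h1])
    · exact Or.inr (by rw [h1])
  left_mem_of_isLink := fun _ _ _ _ => Set.mem_univ _

/-- The probability that the random multigraph of the configuration model (given by a uniformly
random pairing of the half-edges) has the property `P`. -/
noncomputable def configProb (N d : ℕ)
    (P : Graph (Fin N) (Sym2 (Fin N × Fin d)) → Prop) : ℝ :=
  (Nat.card {σ : Pairing N d // P (configGraph σ)} : ℝ) / (Nat.card (Pairing N d) : ℝ)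

/-- A `k`-star of a multigraph with center `v`: a set of exactly `k` edges all incident
with `v`. -/
def IsStarAt {α β : Type*} (G : Graph α β) (k : ℕ) (v : α) (S : Finset β) : Prop :=
  S.card = k ∧ ∀ e ∈ S, G.Inc e v

/-- `G` has a `k`-star decomposition (a partition of its edge set into `k`-stars) in which exactly
`n v` stars are centered at each vertex `v`: here `S v 0, …, S v (n v - 1)` are the stars centered
at `v`. -/
def HasStarDecomposition {α β : Type*} (G : Graph α β) (k : ℕ) (n : α → ℕ) : Prop :=
  ∃ S : (v : α) → Fin (n v) → Finset β,
    (∀ v i, IsStarAt G k v (S v i)) ∧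
    ∀ e ∈ G.edgeSet, ∃! p : (v : α) × Fin (n v), e ∈ S p.1 p.2

/-- `F(x,t) = ½ h(tx) + h((1-t)x) + ½ h(1-(2-t)x) - H(x)`, where `h(x) = -x log x`
(`Real.negMulLog`) and `H(x) = h(x) + h(1-x)` (`Real.binEntropy`). -/
noncomputable def rateF (x t : ℝ) : ℝ :=
  1 / 2 * Real.negMulLog (t * x) + Real.negMulLog ((1 - t) * x)
    + 1 / 2 * Real.negMulLog (1 - (2 - t) * x) - Real.binEntropy x

/-- `F_d(x,t) = d F(x,t) + H(x)`. -/
noncomputable def rateFd (d : ℕ) (x t : ℝ) : ℝ :=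
  (d : ℝ) * rateF x t + Real.binEntropy x

/-!
Assigning every edge to the star that contains it turns a star decomposition with prescribed numbers
`n v` of stars into a perfect matching between the edges and the `k * n v` places at each vertex
`v`. By Hall's theorem it exists as soon as every vertex set `U` spans at most `k * ∑ v ∈ U, n v`
edges (`hasStarDecomposition_of_innerCount_le`). Taking the worst choice of `A₁` for each `U`, and
passing to complements when `U` is so large that it has to meet `A₁`, all the prescriptions in
question follow from two sparsity conditions: nonempty sets of at most `x₀ N` vertices span fewer
than `t₀ d / 2` edges per vertex, and nonempty sets of at most `(1 - x₀) N` vertices span fewer than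
`t₁ d / 2 = s k` edges per vertex (`hasStarDecomposition_of_sparse`).

Both conditions are proved with a union bound. For a fixed set `S` of half-edges and a random
pairing, the number of half-edges of `S` matched inside `S` has the same law as for a fixed pairing
and a random set of the same size (`card_pairing_mul_choose_le`). In the latter model the generating
function is a power, since the pairs contribute independent factors
(`sum_pow_card_mul_pow_innerCount`), and Chernoff's bound with the optimal tilt yields exactly the
exponent `F + H`, without a polynomial factor (`card_le_exp_rateF`). With Stirling's formula for the
number of all sets of that size, the sets of `w` vertices contribute at most
`e² d w exp (N F_d(w / N, t))`.

It remains to see that these terms sum to `o(1)`. The second derivative of `F_d(·, t)` has the sign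
of an affine function, so that `F_d(·, t)` is first convex and then concave on `[0, t]`. As it
vanishes at `0` and is positive at `t`, its negativity at one point `x₁ < t` forces
`F_d(x, t) ≤ -δ x` on `[0, x₁]`, and also `d t / 2 > 1` (`exists_rateFd_le`). This dominates the
terms; each one tends to `0`, because `F_d(x, t)` is at most `(d t / 2 - 1) x log x + O(x)` near
`0`. The hypothesis is the negativity at `(x₀, t₀)`, and the symmetry of the rate under complements
(`rateFd_compl`) carries it over to `(1 - x₀, t₁)`.
-/

/-! ### Sets and involutions without fixed points -/

/-- The number of elements of `S` that the permutation `σ` keeps inside `S`. For an involution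
without fixed points this is twice the number of pairs `{h, σ h}` contained in `S`. -/
def innerCount {H : Type*} [DecidableEq H] (σ : Equiv.Perm H) (S : Finset H) : ℕ :=
  (S.filter fun h => σ h ∈ S).card

/-- An involution without fixed points is conjugate to the flip of the second coordinate on
`T × Bool`, where `T` is a transversal of its orbits. -/
lemma exists_equiv_prod_bool {H : Type*} [Fintype H] (σ : Equiv.Perm H)
    (hσ : ∀ h, σ (σ h) = h ∧ σ h ≠ h) :
    ∃ (T : Type) (_ : Fintype T) (e : T × Bool ≃ H), ∀ x b, σ (e (x, b)) = e (x, !b) := by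
  classical
  let r := Fintype.equivFin H
  let T := {i : Fin (Fintype.card H) // i < r (σ (r.symm i))}
  let f : T × Bool → H := fun p => if p.2 then r.symm p.1.1 else σ (r.symm p.1.1)
  have hinj : Function.Injective f := by
    rintro ⟨⟨i, hi⟩, b⟩ ⟨⟨j, hj⟩, c⟩ h
    cases b <;> cases c <;> simp [f] at h
    · simp [h]
    · rw [← h] at hj
      simp [(hσ _).1] at hj
      have h' : j = r (σ (r.symm i)) := by rw [h]; simp
      exact absurd (hi.trans_eq h'.symm) hj.not_gt
    · rw [h] at hi
      simp [(hσ _).1] at hi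
      have h' : i = r (σ (r.symm j)) := by rw [← h]; simp
      exact absurd (hj.trans_eq h'.symm) hi.not_gt
    · simp [h]
  have hsurj : Function.Surjective f := by
    intro h
    rcases lt_or_gt_of_ne (fun hh => (hσ h).2 (r.injective hh).symm : r h ≠ r (σ h)) with hlt | hlt
    · exact ⟨(⟨r h, by simpa using hlt⟩, true), by simp [f]⟩
    · exact ⟨(⟨r (σ h), by simpa [(hσ h).1] using hlt⟩, false), by simp [f, (hσ h).1]⟩
  refine ⟨T, inferInstance, Equiv.ofBijective f ⟨hinj, hsurj⟩, ?_⟩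
  rintro x (_ | _)
  · exact (hσ _).1
  · rfl

section Involution

variable {H : Type*} [Fintype H] [DecidableEq H]

/-- The joint generating function of the size of a subset and of the number of its elements that
are matched inside it: each of the orbits of `σ` contributes the factor `1 + 2y + ζ²y²`. -/
lemma sum_pow_card_mul_pow_innerCount {T : Type} [Fintype T] (σ : Equiv.Perm H)
    (e : T × Bool ≃ H) (he : ∀ x b, σ (e (x, b)) = e (x, !b)) (y ζ : ℝ) :
    ∑ S : Finset H, y ^ S.card * ζ ^ innerCount σ S
      = (1 + 2 * y + ζ ^ 2 * y ^ 2) ^ Fintype.card T := by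
  classical
  let g : (Bool → Bool) → ℝ := fun φ =>
    ∏ b, ((if φ b then y else 1) * (if φ b && φ (!b) then ζ else 1))
  let E : (T → Bool → Bool) ≃ Finset H :=
    { toFun := fun f => Finset.univ.filter fun h => f (e.symm h).1 (e.symm h).2 = true
      invFun := fun S t b => decide (e (t, b) ∈ S)
      left_inv := fun f => by ext t b; simp
      right_inv := fun S => by ext h; simp }
  have key : ∀ f : T → Bool → Bool,
      y ^ (E f).card * ζ ^ innerCount σ (E f) = ∏ t, g (f t) := by
    intro f
    have h1 : y ^ (E f).card = ∏ p : T × Bool, if f p.1 p.2 then y else 1 := by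
      rw [← Equiv.prod_comp e.symm, Finset.prod_ite]
      simp [E]
    have hmem : ∀ h, σ h ∈ E f ↔ f (e.symm h).1 (!(e.symm h).2) = true := by
      intro h
      obtain ⟨⟨t, b⟩, rfl⟩ := e.surjective h
      simp [E, he]
    have h2 : ζ ^ innerCount σ (E f)
        = ∏ p : T × Bool, if f p.1 p.2 && f p.1 (!p.2) then ζ else 1 := by
      rw [← Equiv.prod_comp e.symm, Finset.prod_ite]
      simp only [innerCount, hmem, Finset.prod_const, one_pow, mul_one]
      congr 2
      ext h
      simp [E]
    rw [h1, h2, ← Finset.prod_mul_distrib, Fintype.prod_prod_type]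
  rw [← Equiv.sum_comp E, Finset.sum_congr rfl fun f _ => key f]
  have h3 := Finset.prod_univ_sum (fun _ : T => (Finset.univ : Finset (Bool → Bool)))
    (fun _ φ => g φ)
  rw [Fintype.piFinset_univ] at h3
  rw [← h3, Finset.prod_const, Finset.card_univ]
  congr 1
  rw [← Equiv.sum_comp (Equiv.boolArrowEquivProd Bool).symm, Fintype.sum_prod_type]
  simp [g, Equiv.boolArrowEquivProd]
  ring

/-- Chernoff's bound for the number of subsets of size `a` having at least `m` elements that are
matched inside the subset. -/
lemma card_le_of_innerCount {T : Type} [Fintype T] (σ : Equiv.Perm H)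
    (e : T × Bool ≃ H) (he : ∀ x b, σ (e (x, b)) = e (x, !b)) {y ζ : ℝ} (hy : 0 < y)
    (hζ : 1 ≤ ζ) (a m : ℕ) :
    (((Finset.univ.powersetCard a).filter fun S : Finset H => m ≤ innerCount σ S).card : ℝ)
        * (y ^ a * ζ ^ m) ≤ (1 + 2 * y + ζ ^ 2 * y ^ 2) ^ Fintype.card T := by
  rw [← sum_pow_card_mul_pow_innerCount σ e he, ← nsmul_eq_mul, ← Finset.sum_const]
  refine (Finset.sum_le_sum (g := fun S => y ^ S.card * ζ ^ innerCount σ S) fun S hS => ?_).trans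
    (Finset.sum_le_sum_of_subset_of_nonneg (Finset.subset_univ _) fun S _ _ => by positivity)
  simp only [Finset.mem_filter, Finset.mem_powersetCard] at hS
  rw [hS.1.2]
  gcongr
  exact hS.2

end Involution

/-! ### Relabelling symmetry of random pairings -/

section Symmetry

variable {N d : ℕ}

noncomputable instance : Fintype (Pairing N d) := by
  classical exact inferInstanceAs (Fintype {σ : Equiv.Perm (Fin N × Fin d) // _})

/-- Relabelling the half-edges by a permutation `π` acts on pairings by conjugation. -/
def Pairing.conj (π : Equiv.Perm (Fin N × Fin d)) : Pairing N d ≃ Pairing N d where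
  toFun σ := ⟨π * σ.1 * π⁻¹, fun h => by
    refine ⟨by simp [(σ.2 _).1], fun hh => (σ.2 (π⁻¹ h)).2 ?_⟩
    apply π.injective
    simpa using hh⟩
  invFun σ := ⟨π⁻¹ * σ.1 * π, fun h => by
    refine ⟨by simp [(σ.2 _).1], fun hh => (σ.2 (π h)).2 ?_⟩
    apply π⁻¹.injective
    simpa using hh⟩
  left_inv σ := Subtype.ext (by simp [mul_assoc])
  right_inv σ := Subtype.ext (by simp [mul_assoc])

lemma Pairing.conj_apply (π : Equiv.Perm (Fin N × Fin d)) (σ : Pairing N d) (h : Fin N × Fin d) :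
    (Pairing.conj π σ).1 h = π (σ.1 (π⁻¹ h)) := rfl

lemma innerCount_conj (π : Equiv.Perm (Fin N × Fin d)) (σ : Pairing N d)
    (S : Finset (Fin N × Fin d)) :
    innerCount (Pairing.conj π σ).1 (S.map π.toEmbedding) = innerCount σ.1 S := by
  unfold innerCount
  rw [Finset.filter_map, Finset.card_map]
  congr 1
  ext h
  simp [Pairing.conj_apply]

/-- The law of `innerCount σ S` for a uniformly random pairing `σ` depends on `S` only through its
size. -/
lemma card_innerCount_eq (S S' : Finset (Fin N × Fin d)) (h : S.card = S'.card) (m : ℕ) :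
    (Finset.univ.filter fun σ : Pairing N d => m ≤ innerCount σ.1 S).card
      = (Finset.univ.filter fun σ : Pairing N d => m ≤ innerCount σ.1 S').card := by
  classical
  let π : Equiv.Perm (Fin N × Fin d) :=
    Equiv.extendSubtype (p := (· ∈ S)) (q := (· ∈ S')) (Finset.equivOfCardEq h)
  have hπ : S.map π.toEmbedding = S' := by
    apply Finset.eq_of_subset_of_card_le
    · intro x hx
      obtain ⟨z, hz, rfl⟩ := Finset.mem_map.1 hx
      exact Equiv.extendSubtype_mem (p := (· ∈ S)) (q := (· ∈ S')) _ z hz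
    · simp [h]
  refine Finset.card_equiv (Pairing.conj π) fun σ => ?_
  simp [← hπ, innerCount_conj]

/-- Double counting: a bound on the number of sets `S` of size `a` that are bad for a fixed pairing
gives a bound on the number of pairings that are bad for a fixed `S`. -/
lemma card_pairing_mul_choose_le (S : Finset (Fin N × Fin d)) (m : ℕ) {B : ℝ}
    (hB : ∀ σ : Pairing N d,
      (((Finset.univ.powersetCard S.card).filter fun S' => m ≤ innerCount σ.1 S').card : ℝ) ≤ B) :
    ((Finset.univ.filter fun σ : Pairing N d => m ≤ innerCount σ.1 S).card : ℝ)
        * (N * d).choose S.card ≤ Fintype.card (Pairing N d) * B := by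
  classical
  have h1 : ∑ S' ∈ Finset.univ.powersetCard S.card,
      (Finset.univ.filter fun σ : Pairing N d => m ≤ innerCount σ.1 S').card
      = ∑ σ : Pairing N d,
        ((Finset.univ.powersetCard S.card).filter fun S' => m ≤ innerCount σ.1 S').card :=
    Finset.sum_card_bipartiteAbove_eq_sum_card_bipartiteBelow
      (fun S' (σ : Pairing N d) => m ≤ innerCount σ.1 S')
  have h2 : ∑ S' ∈ Finset.univ.powersetCard S.card,
      (Finset.univ.filter fun σ : Pairing N d => m ≤ innerCount σ.1 S').card
      = (N * d).choose S.card *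
        (Finset.univ.filter fun σ : Pairing N d => m ≤ innerCount σ.1 S).card := by
    rw [Finset.sum_congr rfl fun S' hS' =>
      card_innerCount_eq S' S (Finset.mem_powersetCard.1 hS').2 m]
    simp
  rw [mul_comm, ← Nat.cast_mul, ← h2, h1, Nat.cast_sum, ← nsmul_eq_mul, ← Finset.card_univ,
    ← Finset.sum_const]
  exact Finset.sum_le_sum fun σ _ => hB σ

lemma nonempty_pairing (h : 2 ∣ N * d) : Nonempty (Pairing N d) := by
  obtain ⟨p, hp⟩ := h
  have e : Fin N × Fin d ≃ Fin p × Bool :=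
    Fintype.equivOfCardEq (by simp [hp, mul_comm])
  refine ⟨⟨(e.trans ((Equiv.refl _).prodCongr Equiv.boolNot)).trans e.symm, fun h => ?_⟩⟩
  refine ⟨?_, fun hh => ?_⟩
  · have : ∀ q : Fin p × Bool, Prod.map id Equiv.boolNot (Prod.map id Equiv.boolNot q) = q := by
      rintro ⟨x, _ | _⟩ <;> rfl
    simp [this]
  rw [Equiv.trans_apply, Equiv.symm_apply_eq] at hh
  have := congrArg Prod.snd hh
  simp at this

end Symmetry

/-! ### Entropy bounds -/

lemma log_factorial_le {n : ℕ} (hn : n ≠ 0) :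
    Real.log n.factorial ≤ n * Real.log n - n + Real.log n / 2 + 1 := by
  obtain ⟨m, rfl⟩ := Nat.exists_eq_succ_of_ne_zero hn
  have h1 := Stirling.log_stirlingSeq'_antitone (Nat.zero_le m)
  simp only [Function.comp_apply] at h1
  rw [Stirling.log_stirlingSeq_formula, Stirling.log_stirlingSeq_formula,
    Real.log_div (by positivity) (by positivity), Real.log_mul (by positivity) (by positivity),
    Real.log_mul (by positivity) (by positivity)] at h1
  simp at h1
  push_cast at h1 ⊢
  linarith

/-- Stirling's formula bounds a binomial coefficient below by its entropy, up to a factor that is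
linear in `a`. -/
lemma exp_mul_binEntropy_le_choose {n a : ℕ} (ha : 0 < a) (han : a < n) :
    Real.exp (n * Real.binEntropy (a / n)) ≤ Real.exp 2 * a * n.choose a := by
  obtain ⟨b, rfl⟩ := Nat.exists_eq_add_of_lt han
  set c := b + 1 with hc
  rw [show a + b + 1 = a + c by omega] at *
  have ha' : (0 : ℝ) < a := by exact_mod_cast ha
  have hc' : (0 : ℝ) < c := by rw [hc]; positivity
  have hpos : (0 : ℝ) < (a + c).choose a := by exact_mod_cast Nat.choose_pos (by omega)
  rw [← Real.le_log_iff_exp_le (by positivity), Real.log_mul (by positivity) (by positivity),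
    Real.log_mul (by positivity) (by positivity), Real.log_exp]
  have h1 : (((a + c).choose a : ℕ) : ℝ) * c.factorial * a.factorial = (a + c).factorial := by
    have := Nat.add_choose_mul_factorial_mul_factorial c a
    rw [add_comm c a] at this
    rw [← this, Nat.choose_symm_add]
    push_cast; ring
  have h2 := congrArg Real.log h1
  rw [Real.log_mul (by positivity) (by positivity), Real.log_mul (by positivity) (by positivity)]
    at h2
  have h3 := log_factorial_le ha.ne'
  have h4 := log_factorial_le (n := c) (by omega)
  have h5 := Stirling.le_log_factorial_stirling (n := a + c) (by omega)
  have h6 : Real.log c ≤ Real.log ((a + c : ℕ) : ℝ) :=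
    Real.log_le_log hc' (by push_cast; linarith)
  have h7 : 0 ≤ Real.log a := Real.log_natCast_nonneg a
  have h8 : 0 ≤ Real.log (2 * Real.pi) :=
    Real.log_nonneg (by nlinarith [Real.pi_gt_three])
  have h9 : ((a + c : ℕ) : ℝ) * Real.binEntropy (a / (a + c : ℕ))
      = (a + c : ℕ) * Real.log (a + c : ℕ) - a * Real.log a - c * Real.log c := by
    have e1 : (1 : ℝ) - a / (a + c : ℕ) = c / (a + c : ℕ) := by
      push_cast; field_simp; ring
    rw [Real.binEntropy_eq_negMulLog_add_negMulLog_one_sub, e1, Real.negMulLog, Real.negMulLog,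
      Real.log_div (by positivity) (by positivity), Real.log_div (by positivity) (by positivity)]
    push_cast
    field_simp
    ring
  rw [h9]
  push_cast at *
  linarith

lemma choose_le_exp_mul_binEntropy {n a : ℕ} (ha : 0 < a) (han : a < n) :
    (n.choose a : ℝ) ≤ Real.exp (n * Real.binEntropy (a / n)) := by
  have hn : (0 : ℝ) < n := by exact_mod_cast (by omega : 0 < n)
  have ha' : (0 : ℝ) < a := by exact_mod_cast ha
  have han' : (a : ℝ) < n := by exact_mod_cast han
  have hp : (0 : ℝ) < a / n := by positivity
  have hq : (0 : ℝ) < 1 - a / n := by rw [sub_pos, div_lt_one hn]; exact han'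
  have h1 : (a / n : ℝ) ^ a * (1 - a / n) ^ (n - a) * n.choose a ≤ 1 := by
    calc _ ≤ ((a / n : ℝ) + (1 - a / n)) ^ n := by
          rw [add_pow]
          exact Finset.single_le_sum (f := fun m => (a / n : ℝ) ^ m * (1 - a / n) ^ (n - m) *
            n.choose m) (fun m _ => by positivity) (Finset.mem_range.2 (by omega))
      _ = 1 := by simp
  have h2 : (a / n : ℝ) ^ a * (1 - a / n) ^ (n - a)
      = Real.exp (-(n * Real.binEntropy (a / n))) := by
    have e1 (u : ℝ) (hu : 0 < u) (j : ℕ) : u ^ j = Real.exp (j * Real.log u) := by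
      rw [Real.exp_nat_mul, Real.exp_log hu]
    rw [e1 _ hp, e1 _ hq, ← Real.exp_add, Nat.cast_sub han.le]
    congr 1
    rw [Real.binEntropy_eq_negMulLog_add_negMulLog_one_sub, Real.negMulLog, Real.negMulLog]
    field_simp
    ring
  rw [h2, Real.exp_neg, inv_mul_le_iff₀ (Real.exp_pos _), mul_one] at h1
  exact h1

/-- The Chernoff bound optimized: among the sets of size `x n` those with `t x n` elements matched
inside number at most `exp (n (F(x,t) + H(x)))`. -/
lemma card_le_exp_rateF {H : Type*} [Fintype H] [DecidableEq H] (σ : Equiv.Perm H)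
    (hσ : ∀ h, σ (σ h) = h ∧ σ h ≠ h) {x t : ℝ} (hx : 0 < x) (hxt : x ≤ t) (ht : t < 1)
    {a m : ℕ} (ha : (a : ℝ) = x * Fintype.card H) (hm : (m : ℝ) = t * x * Fintype.card H) :
    (((Finset.univ.powersetCard a).filter fun S : Finset H => m ≤ innerCount σ S).card : ℝ)
      ≤ Real.exp (Fintype.card H * (rateF x t + Real.binEntropy x)) := by
  obtain ⟨T, _, e, he⟩ := exists_equiv_prod_bool σ hσ
  have hn : (Fintype.card H : ℝ) = 2 * Fintype.card T := by
    rw [← Fintype.card_congr e]; simp [mul_comm]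
  have ht0 : 0 < t := hx.trans_le hxt
  have hA : 0 < t * x := by positivity
  have hB : 0 < (1 - t) * x := mul_pos (by linarith) hx
  have hq : 0 < 1 - (2 - t) * x := by nlinarith [sq_pos_of_pos (sub_pos.2 ht)]
  set q := 1 - (2 - t) * x with hqd
  -- The minimizing tilt: a pair is inside `S`, split, or outside with probabilities
  -- `t x`, `2 (1 - t) x` and `q`.
  set Y := Real.log ((1 - t) * x) - Real.log q with hY
  set Z := (Real.log (t * x) + Real.log q) / 2 - Real.log ((1 - t) * x) with hZ
  have hZ0 : 0 ≤ Z := by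
    have h1 : Real.log (((1 - t) * x) ^ 2) ≤ Real.log (t * x * q) := by
      apply Real.log_le_log (by positivity)
      rw [hqd]
      nlinarith [mul_nonneg hx.le (sub_nonneg.2 hxt)]
    rw [Real.log_pow, Real.log_mul hA.ne' hq.ne'] at h1
    push_cast at h1
    rw [hZ]; linarith
  have h1 := card_le_of_innerCount σ e he (Real.exp_pos Y) (Real.one_le_exp hZ0) a m
  have h2 : 1 + 2 * Real.exp Y + Real.exp Z ^ 2 * Real.exp Y ^ 2 = Real.exp (-Real.log q) := by
    have e1 : Real.exp Y = (1 - t) * x / q := by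
      rw [hY, Real.exp_sub, Real.exp_log hB, Real.exp_log hq]
    have e2 : Real.exp Z ^ 2 * Real.exp Y ^ 2 = t * x / q := by
      rw [← Real.exp_nat_mul, ← Real.exp_nat_mul, ← Real.exp_add,
        ← Real.exp_log (div_pos hA hq), Real.log_div hA.ne' hq.ne']
      congr 1
      rw [hY, hZ]; push_cast; ring
    rw [e2, e1, Real.exp_neg, Real.exp_log hq]
    field_simp
    rw [hqd]; ring
  rw [h2, ← Real.exp_nat_mul, ← Real.exp_nat_mul, ← Real.exp_nat_mul, ← Real.exp_add,
    ← le_div_iff₀ (Real.exp_pos _), ← Real.exp_sub] at h1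
  refine h1.trans_eq ?_
  congr 1
  rw [ha, hm, rateF, Real.negMulLog, Real.negMulLog, Real.negMulLog, ← hqd, hY, hZ]
  rw [hn, hqd]
  ring

/-! ### The rate function -/

section RateFunction

variable {d : ℕ} {t : ℝ}

lemma rateFd_zero : rateFd d 0 t = 0 := by simp [rateFd, rateF]

lemma continuous_rateFd : Continuous fun x => rateFd d x t := by
  unfold rateFd rateF
  fun_prop

lemma rateFd_self (ht : t < 1) : rateFd d t t = Real.binEntropy t := by
  have h : rateF t t = 0 := by
    have h1 : 0 < 1 - t := by linarith
    rw [rateF, Real.binEntropy_eq_negMulLog_add_negMulLog_one_sub,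
      show 1 - (2 - t) * t = (1 - t) * (1 - t) by ring]
    simp only [Real.negMulLog_mul]
    ring
  rw [rateFd, h]; ring

/-- Exchanging a set with its complement preserves the rate. -/
lemma rateFd_compl {x y u : ℝ} (hy : y = 1 - x) (hu : (1 - u) * y = (1 - t) * x) :
    rateFd d y u = rateFd d x t := by
  have h1 : u * y = 1 - (2 - t) * x := by rw [hy] at hu ⊢; linarith
  have h2 : 1 - (2 - u) * y = t * x := by rw [hy] at hu ⊢; linarith
  rw [rateFd, rateFd, rateF, rateF, h1, h2, hu, hy, Real.binEntropy_one_sub]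
  ring

variable (d t) in
/-- The first derivative of `rateFd d · t`. -/
noncomputable def rateFdDeriv (x : ℝ) : ℝ :=
  d * (1 / 2 * (t * (-Real.log (t * x) - 1)) + (1 - t) * (-Real.log ((1 - t) * x) - 1)
    - 1 / 2 * ((2 - t) * (-Real.log (1 - (2 - t) * x) - 1)))
    + (1 - d) * (Real.log (1 - x) - Real.log x)

lemma hasDerivAt_rateFd (ht0 : 0 < t) (ht : t < 1) {x : ℝ} (hx0 : 0 < x) (hxt : x < t) :
    HasDerivAt (fun x => rateFd d x t) (rateFdDeriv d t x) x := by
  have hA : t * x ≠ 0 := by positivity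
  have hB : (1 - t) * x ≠ 0 := (mul_pos (by linarith) hx0).ne'
  have hq : 1 - (2 - t) * x ≠ 0 := by nlinarith [sq_pos_of_pos (sub_pos.2 ht)]
  have lin (c : ℝ) : HasDerivAt (fun x => c * x) c x := by
    simpa using (hasDerivAt_id x).const_mul c
  have h1 := (Real.hasDerivAt_negMulLog hA).comp x (lin t)
  have h2 := (Real.hasDerivAt_negMulLog hB).comp x (lin (1 - t))
  have h3 := (Real.hasDerivAt_negMulLog hq).comp x ((lin (2 - t)).const_sub 1)
  have h4 := Real.hasDerivAt_binEntropy hx0.ne' (by linarith : x ≠ 1)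
  have h5 := ((((h1.const_mul (1 / 2)).add h2).add (h3.const_mul (1 / 2))).sub h4).const_mul (d : ℝ)
  refine (h5.add h4).congr_deriv ?_
  rw [rateFdDeriv]
  ring

lemma hasDerivAt_rateFdDeriv (ht0 : 0 < t) (ht : t < 1) {x : ℝ} (hx0 : 0 < x) (hxt : x < t) :
    HasDerivAt (rateFdDeriv d t)
      ((d * t / 2 - 1 - x * (d * t / 2 - 1 + (d - 1) * (1 - t)))
        / (x * (1 - x) * (1 - (2 - t) * x))) x := by
  have hA : t * x ≠ 0 := by positivity
  have ht1 : 1 - t ≠ 0 := by linarith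
  have hB : (1 - t) * x ≠ 0 := (mul_pos (by linarith) hx0).ne'
  have hq : 1 - (2 - t) * x ≠ 0 := by nlinarith [sq_pos_of_pos (sub_pos.2 ht)]
  have hq' : 1 - x * (2 - t) ≠ 0 := by rwa [mul_comm]
  have hx1 : 1 - x ≠ 0 := by linarith
  have lin (c : ℝ) : HasDerivAt (fun x => c * x) c x := by
    simpa using (hasDerivAt_id x).const_mul c
  have h1 := ((((lin t).log hA).neg.sub_const 1).const_mul t).const_mul (1 / 2)
  have h2 := (((lin (1 - t)).log hB).neg.sub_const 1).const_mul (1 - t)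
  have h3 := (((((lin (2 - t)).const_sub 1).log hq).neg.sub_const 1).const_mul (2 - t)).const_mul
    (1 / 2)
  have h4 := ((((hasDerivAt_id x).const_sub 1).log hx1).sub (Real.hasDerivAt_log hx0.ne')).const_mul
    (1 - d : ℝ)
  refine ((((h1.add h2).sub h3).const_mul (d : ℝ)).add h4).congr_deriv ?_
  simp only [id]
  field_simp
  ring

/-- If the rate is negative at some `x₁ < t`, then it lies below a decreasing linear function on all
of `[0, x₁]`. The rate vanishes at `0`, is positive at `t`, and in between is first convex and then
concave: its second derivative has the sign of an affine function. -/
lemma exists_rateFd_le {x₁ : ℝ} (ht : t < 1) (hx₁ : 0 < x₁) (hxt : x₁ < t) (hd : 1 ≤ d)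
    (hc : 0 ≤ d * t / 2 - 1) (hneg : rateFd d x₁ t < 0) :
    0 < d * t / 2 - 1 ∧ ∃ δ > 0, ∀ x, 0 ≤ x → x ≤ x₁ → rateFd d x t ≤ -δ * x := by
  have ht0 : 0 < t := hx₁.trans hxt
  have hd' : (1 : ℝ) ≤ d := by exact_mod_cast hd
  set c := (d : ℝ) * t / 2 - 1 with hcd
  set K := c + (d - 1) * (1 - t) with hK
  have hKpos : 0 ≤ K := by
    have := mul_nonneg (sub_nonneg.2 hd') (sub_nonneg.2 ht.le)
    linarith
  have hcK : c ≤ K := by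
    have := mul_nonneg (sub_nonneg.2 hd') (sub_nonneg.2 ht.le)
    linarith
  have hden : ∀ x, 0 < x → x < t → 0 < x * (1 - x) * (1 - (2 - t) * x) := by
    intro x h0 h1
    have : 0 < 1 - (2 - t) * x := by nlinarith [sq_pos_of_pos (sub_pos.2 ht)]
    exact mul_pos (mul_pos h0 (by linarith)) this
  have hconvex : ∀ b, b ≤ t → b * K ≤ c →
      ConvexOn ℝ (Set.Icc 0 b) fun x => rateFd d x t := by
    intro b hbt hbK
    refine convexOn_of_hasDerivWithinAt2_nonneg (convex_Icc 0 b) continuous_rateFd.continuousOn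
      (f' := rateFdDeriv d t) (f'' := fun x => (c - x * K) / (x * (1 - x) * (1 - (2 - t) * x)))
      ?_ ?_ ?_
    all_goals
      intro x hx
      rw [interior_Icc] at hx
    · exact (hasDerivAt_rateFd ht0 ht hx.1 (hx.2.trans_le hbt)).hasDerivWithinAt
    · exact (hasDerivAt_rateFdDeriv ht0 ht hx.1 (hx.2.trans_le hbt)).hasDerivWithinAt
    · refine div_nonneg ?_ (hden x hx.1 (hx.2.trans_le hbt)).le
      nlinarith [hx.2, mul_le_mul_of_nonneg_right hx.2.le hKpos]
  have hconcave : ∀ b, 0 ≤ b → c ≤ b * K →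
      ConcaveOn ℝ (Set.Icc b t) fun x => rateFd d x t := by
    intro b hb hbK
    refine concaveOn_of_hasDerivWithinAt2_nonpos (convex_Icc b t) continuous_rateFd.continuousOn
      (f' := rateFdDeriv d t) (f'' := fun x => (c - x * K) / (x * (1 - x) * (1 - (2 - t) * x)))
      ?_ ?_ ?_
    all_goals
      intro x hx
      rw [interior_Icc] at hx
    · exact (hasDerivAt_rateFd ht0 ht (hb.trans_lt hx.1) hx.2).hasDerivWithinAt
    · exact (hasDerivAt_rateFdDeriv ht0 ht (hb.trans_lt hx.1) hx.2).hasDerivWithinAt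
    · refine div_nonpos_of_nonpos_of_nonneg ?_ (hden x (hb.trans_lt hx.1) hx.2).le
      nlinarith [hx.1, mul_le_mul_of_nonneg_right hx.1.le hKpos]
  have hft : 0 < rateFd d t t := by
    rw [rateFd_self ht]; exact Real.binEntropy_pos ht0 ht
  have hchord : ∀ b, 0 < b → b ≤ t → b * K ≤ c → ∀ x, 0 ≤ x → x ≤ b →
      rateFd d x t ≤ x / b * rateFd d b t := by
    intro b hb hbt hbK x hx hxb
    have h := (hconvex b hbt hbK).2 (Set.left_mem_Icc.2 hb.le) (Set.right_mem_Icc.2 hb.le)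
      (sub_nonneg.2 ((div_le_one hb).2 hxb)) (div_nonneg hx hb.le) (sub_add_cancel 1 (x / b))
    simpa [rateFd_zero, div_mul_cancel₀ x hb.ne'] using h
  -- A concave function is quasiconcave, so the rate at `x₁` is at least the smaller one of its
  -- values at `x` and at `t`; the latter is positive.
  have hleft : ∀ b, 0 ≤ b → c ≤ b * K → ∀ x, b ≤ x → x ≤ x₁ → rateFd d x t ≤ rateFd d x₁ t := by
    intro b hb hbK x hbx hx
    have h := (hconcave b hb hbK).min_le_of_mem_Icc (x := x) (y := t) (z := x₁)
      ⟨hbx, hx.trans hxt.le⟩ ⟨hbx.trans (hx.trans hxt.le), le_rfl⟩ ⟨hx, hxt.le⟩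
    exact (min_le_iff.1 h).resolve_right (by linarith)
  have hcpos : 0 < c := by
    refine hc.lt_of_ne fun h0 => ?_
    have h := hleft 0 le_rfl (by rw [← h0, zero_mul]) 0 le_rfl hx₁.le
    rw [rateFd_zero] at h
    linarith
  refine ⟨hcpos, -rateFd d x₁ t / x₁, div_pos (by linarith) hx₁, fun x hx0 hx => ?_⟩
  rw [show -(-rateFd d x₁ t / x₁) * x = x / x₁ * rateFd d x₁ t by ring]
  rcases le_or_gt (x₁ * K) c with hx₁K | hx₁K
  · exact hchord x₁ hx₁ hxt.le hx₁K x hx0 hx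
  have hK0 : 0 < K := by linarith
  have hξ0 : 0 < c / K := by positivity
  have hξ1 : c / K < x₁ := by rwa [div_lt_iff₀ hK0]
  have hξK : c / K * K = c := div_mul_cancel₀ c hK0.ne'
  rcases le_total x (c / K) with hxξ | hxξ
  · refine (hchord (c / K) hξ0 (hξ1.trans hxt).le hξK.le x hx0 hxξ).trans ?_
    refine (mul_le_mul_of_nonneg_left (hleft _ hξ0.le hξK.ge _ le_rfl hξ1.le) (by positivity)).trans
      ?_
    exact mul_le_mul_of_nonpos_right (div_le_div_of_nonneg_left hx0 hξ0 hξ1.le) hneg.le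
  · refine (hleft _ hξ0.le hξK.ge x hxξ hx).trans ?_
    nlinarith [(div_le_one hx₁).2 hx]

/-- Near `0` the rate is dominated by `(d t / 2 - 1) x log x`. -/
lemma rateFd_le_mul_log (ht0 : 0 < t) (ht : t < 1) (hd : 1 ≤ d) :
    ∃ C : ℝ, ∀ x, 0 < x → x < t → rateFd d x t ≤ x * ((d * t / 2 - 1) * Real.log x + C) := by
  refine ⟨d * (-t / 2 * Real.log t - (1 - t) * Real.log (1 - t) + (2 - t) / 2), fun x hx hxt => ?_⟩
  have h1t : 0 < 1 - t := by linarith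
  have hq : 0 < 1 - (2 - t) * x := by nlinarith [sq_pos_of_pos h1t]
  have h1 : Real.negMulLog (1 - (2 - t) * x) ≤ (2 - t) * x := by
    simpa using Real.negMulLog_le_one_sub_self hq.le
  have h2 : 0 ≤ Real.negMulLog (1 - x) := Real.negMulLog_nonneg (by linarith) (by linarith)
  have hd' : (1 : ℝ) ≤ d := by exact_mod_cast hd
  rw [rateFd, rateF, Real.binEntropy_eq_negMulLog_add_negMulLog_one_sub, Real.negMulLog_mul,
    Real.negMulLog_mul]
  have h3 := mul_le_mul_of_nonneg_left h1 (by linarith : (0 : ℝ) ≤ d)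
  have h4 := mul_nonneg (sub_nonneg.2 hd') h2
  simp only [Real.negMulLog] at *
  linarith

end RateFunction

/-! ### Star decompositions from sparsity -/

section StarDecomposition

lemma innerCount_empty {H : Type*} [DecidableEq H] (σ : Equiv.Perm H) : innerCount σ ∅ = 0 := by
  simp [innerCount]

/-- The elements matched across a set and its complement are equinumerous on both sides. -/
lemma innerCount_add_card_compl {H : Type*} [Fintype H] [DecidableEq H] (σ : Equiv.Perm H)
    (hσ : ∀ h, σ (σ h) = h ∧ σ h ≠ h) (S : Finset H) :
    innerCount σ S + Sᶜ.card = innerCount σ Sᶜ + S.card := by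
  have h1 := S.card_filter_add_card_filter_not (fun h => σ h ∈ S)
  have h2 := Sᶜ.card_filter_add_card_filter_not (fun h => σ h ∈ Sᶜ)
  have h3 : (S.filter fun h => ¬ σ h ∈ S).card = (Sᶜ.filter fun h => ¬ σ h ∈ Sᶜ).card :=
    Finset.card_equiv σ fun h => by simp [(hσ h).1, and_comm]
  unfold innerCount
  omega

variable {N d : ℕ}

/-- The half-edges at the vertices of `W`. -/
def halfEdges (d : ℕ) (W : Finset (Fin N)) : Finset (Fin N × Fin d) := W ×ˢ Finset.univ

lemma card_halfEdges (W : Finset (Fin N)) : (halfEdges d W).card = W.card * d := by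
  simp [halfEdges]

lemma mem_halfEdges {W : Finset (Fin N)} {h : Fin N × Fin d} : h ∈ halfEdges d W ↔ h.1 ∈ W := by
  simp [halfEdges]

lemma compl_halfEdges (W : Finset (Fin N)) : (halfEdges d W)ᶜ = halfEdges d Wᶜ := by
  ext h; simp [mem_halfEdges]

lemma configGraph_inc_iff {σ : Pairing N d} {e : Sym2 (Fin N × Fin d)} {v : Fin N} :
    (configGraph σ).Inc e v ↔ ∃ h, e = s(h, σ.1 h) ∧ h.1 = v :=
  ⟨fun ⟨_, h, he, hv, _⟩ => ⟨h, he, hv⟩, fun ⟨h, he, hv⟩ => ⟨_, h, he, hv, rfl⟩⟩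

lemma card_filter_eq_edge (σ : Pairing N d) (h : Fin N × Fin d) :
    (Finset.univ.filter fun g => s(h, σ.1 h) = s(g, σ.1 g)).card = 2 := by
  rw [← Finset.card_pair (σ.2 h).2.symm]
  congr 1
  ext g
  simp only [Finset.mem_filter, Finset.mem_univ, true_and, Sym2.eq_iff, Finset.mem_insert,
    Finset.mem_singleton]
  constructor
  · rintro (⟨h1, -⟩ | ⟨-, h1⟩)
    · exact Or.inl h1.symm
    · exact Or.inr h1.symm
  · rintro (rfl | rfl)
    · simp
    · exact Or.inr ⟨((σ.2 h).1).symm, rfl⟩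

/-- Hall's marriage theorem for edges and places in stars: prescribed numbers of stars can be
realized as soon as no vertex set spans more edges than its stars can take up, and the total number
of places is the number of edges. -/
lemma hasStarDecomposition_of_innerCount_le (σ : Pairing N d) (k : ℕ) (n : Fin N → ℕ)
    (hU : ∀ U : Finset (Fin N), innerCount σ.1 (halfEdges d U) ≤ 2 * ∑ v ∈ U, n v * k)
    (htot : 2 * ∑ v, n v * k = N * d) : HasStarDecomposition (configGraph σ) k n := by
  classical
  let E : Finset (Sym2 (Fin N × Fin d)) := Finset.univ.image fun h => s(h, σ.1 h)
  have hE : ∀ {e}, e ∈ E → ∃ h, e = s(h, σ.1 h) := fun he => by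
    obtain ⟨h, -, rfl⟩ := Finset.mem_image.1 he
    exact ⟨h, rfl⟩
  let Slot := (v : Fin N) × (Fin (n v) × Fin k)
  let t : E → Finset Slot := fun e => Finset.univ.filter fun p => (configGraph σ).Inc e.1 p.1
  have hhall : ∀ A : Finset E, A.card ≤ (A.biUnion t).card := by
    intro A
    let U : Finset (Fin N) := Finset.univ.filter fun v => ∃ e ∈ A, (configGraph σ).Inc e.1 v
    have h1 : A.biUnion t = U.sigma fun _ => Finset.univ := by
      ext p
      simp only [t, Finset.mem_biUnion, Finset.mem_filter, Finset.mem_univ, true_and]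
      exact ⟨fun h => Finset.mem_sigma.2
          ⟨Finset.mem_filter.2 ⟨Finset.mem_univ _, h⟩, Finset.mem_univ _⟩,
        fun h => (Finset.mem_filter.1 (Finset.mem_sigma.1 h).1).2⟩
    have h2 : A.card * 2 ≤
        ((halfEdges d U).filter fun h => σ.1 h ∈ halfEdges d U).card * 1 := by
      refine Finset.card_mul_le_card_mul (fun (e : E) h => e.1 = s(h, σ.1 h)) (fun e he => ?_)
        fun h _ => ?_
      · obtain ⟨h₀, hh₀⟩ := hE e.2
        rw [← card_filter_eq_edge σ h₀]
        refine Finset.card_le_card fun g hg => ?_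
        have hg' : e.1 = s(g, σ.1 g) := hh₀.trans (Finset.mem_filter.1 hg).2
        refine Finset.mem_filter.2 ⟨Finset.mem_filter.2 ⟨?_, ?_⟩, hg'⟩ <;>
          refine mem_halfEdges.2 (Finset.mem_filter.2 ⟨Finset.mem_univ _, e, he, ?_⟩)
        · exact configGraph_inc_iff.2 ⟨g, hg', rfl⟩
        · exact configGraph_inc_iff.2 ⟨σ.1 g, by rw [hg', (σ.2 g).1, Sym2.eq_swap], rfl⟩
      · refine Finset.card_le_one.2 fun e he e' he' => Subtype.ext ?_
        exact (Finset.mem_filter.1 he).2.trans (Finset.mem_filter.1 he').2.symm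
    have h3 := hU U
    rw [h1, Finset.card_sigma]
    simp only [Finset.card_univ, Fintype.card_prod, Fintype.card_fin]
    unfold innerCount at h3
    omega
  obtain ⟨f, hf, hft⟩ := (Finset.all_card_le_biUnion_card_iff_exists_injective t).1 hhall
  have hcard : Fintype.card Slot ≤ Fintype.card E := by
    have h1 : (Finset.univ : Finset (Fin N × Fin d)).card * 1 ≤ E.card * 2 := by
      refine Finset.card_mul_le_card_mul (fun h e => e = s(h, σ.1 h)) (fun h _ => ?_) fun e he => ?_
      · exact Finset.card_pos.2 ⟨s(h, σ.1 h), Finset.mem_filter.2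
          ⟨Finset.mem_image_of_mem _ (Finset.mem_univ h), rfl⟩⟩
      · obtain ⟨h₀, rfl⟩ := hE he
        exact (card_filter_eq_edge σ h₀).le
    simp only [Finset.card_univ, Fintype.card_prod, Fintype.card_fin] at h1
    simp only [Slot, Fintype.card_sigma, Fintype.card_prod, Fintype.card_fin, Fintype.card_coe]
    omega
  have hbij : Function.Bijective f :=
    (Fintype.bijective_iff_injective_and_card f).2
      ⟨hf, (Fintype.card_le_of_injective f hf).antisymm hcard⟩
  let g := Equiv.ofBijective f hbij
  have hginj : ∀ p q : Slot, (g.symm p).1 = (g.symm q).1 → p = q := fun p q h =>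
    g.symm.injective (Subtype.ext h)
  refine ⟨fun v i => Finset.univ.image fun j => (g.symm ⟨v, i, j⟩).1, fun v i => ⟨?_, ?_⟩, ?_⟩
  · rw [Finset.card_image_of_injective _ fun j j' h => by
      have h' := hginj ⟨v, i, j⟩ ⟨v, i, j'⟩ h
      simpa [Slot] using h']
    simp
  · intro e he
    obtain ⟨j, -, rfl⟩ := Finset.mem_image.1 he
    have h := hft (g.symm ⟨v, i, j⟩)
    rw [show f (g.symm ⟨v, i, j⟩) = ⟨v, i, j⟩ from g.apply_symm_apply _] at h
    exact (Finset.mem_filter.1 h).2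
  · rintro e ⟨u, v, h, rfl, -, -⟩
    let e' : E := ⟨s(h, σ.1 h), Finset.mem_image_of_mem _ (Finset.mem_univ h)⟩
    obtain ⟨p, hp⟩ := g.symm.surjective e'
    obtain ⟨v, i, j⟩ := p
    refine ⟨⟨v, i⟩, Finset.mem_image.2 ⟨j, Finset.mem_univ _, by rw [hp]⟩, ?_⟩
    rintro ⟨v', i'⟩ hq
    obtain ⟨j', -, hj'⟩ := Finset.mem_image.1 hq
    have h := hginj ⟨v', i', j'⟩ ⟨v, i, j⟩ (by rw [hp]; exact hj')
    have h4 := congrArg (fun p : Slot => (⟨p.1, p.2.1⟩ : (v : Fin N) × Fin (n v))) h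
    exact h4

/-- The density conditions that suffice for all prescriptions of `s` or `s + 1` stars
simultaneously. Sets with at most `(1 - r / 2k) N` vertices may avoid `A₁`. A larger set
meets `A₁`, and the requirement for it translates into a density condition on its complement. -/
lemma hasStarDecomposition_of_sparse {k s r τ : ℕ} (hk : 0 < k) (hd : d = 2 * s * k + r)
    (hτ : τ + k = s * k + r) (σ : Pairing N d)
    (h₀ : ∀ W : Finset (Fin N), W.Nonempty → (W.card : ℝ) ≤ r / (2 * k) * N →
      innerCount σ.1 (halfEdges d W) < 2 * τ * W.card)
    (h₁ : ∀ W : Finset (Fin N), W.Nonempty → (W.card : ℝ) ≤ (1 - r / (2 * k)) * N →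
      innerCount σ.1 (halfEdges d W) < 2 * (s * k) * W.card)
    (A : Finset (Fin N)) (hA : (A.card : ℝ) = r * N / (2 * k)) :
    HasStarDecomposition (configGraph σ) k (fun v => if v ∈ A then s + 1 else s) := by
  have hk' : (0 : ℝ) < k := by exact_mod_cast hk
  have hA' : 2 * k * A.card = r * N := by
    rw [eq_div_iff (by positivity)] at hA
    have : ((2 * k * A.card : ℕ) : ℝ) = (r * N : ℕ) := by push_cast; linarith
    exact_mod_cast this
  have hsum : ∀ U : Finset (Fin N),
      ∑ v ∈ U, (if v ∈ A then s + 1 else s) * k = (s * U.card + (U ∩ A).card) * k := by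
    intro U
    rw [← Finset.sum_mul, Finset.sum_ite, Finset.sum_const, Finset.sum_const, smul_eq_mul,
      smul_eq_mul, ← U.card_filter_add_card_filter_not (· ∈ A), Finset.filter_mem_eq_inter]
    ring
  refine hasStarDecomposition_of_innerCount_le σ k _ (fun U => ?_) ?_
  · rw [hsum]
    rcases le_or_gt (U.card : ℝ) ((1 - r / (2 * k)) * N) with hle | hgt
    · rcases U.eq_empty_or_nonempty with rfl | hne
      · simp [halfEdges, innerCount_empty]
      · have := h₁ U hne hle
        nlinarith [Nat.zero_le ((U ∩ A).card * k)]
    · have hcU : U.card + Uᶜ.card = N := by simp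
      have hW : innerCount σ.1 (halfEdges d Uᶜ) ≤ 2 * τ * Uᶜ.card := by
        rcases Uᶜ.eq_empty_or_nonempty with he | hne
        · simp [he, halfEdges, innerCount_empty]
        · refine (h₀ Uᶜ hne ?_).le
          have : (U.card : ℝ) + Uᶜ.card = N := by exact_mod_cast hcU
          linarith
      have hcompl := innerCount_add_card_compl σ.1 σ.2 (halfEdges d U)
      rw [compl_halfEdges, card_halfEdges, card_halfEdges] at hcompl
      have hAU : A.card ≤ (U ∩ A).card + Uᶜ.card := by
        rw [← Finset.card_inter_add_card_sdiff A U, Finset.inter_comm]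
        gcongr
        exact fun v hv => Finset.mem_compl.2 (Finset.mem_sdiff.1 hv).2
      have hAU' := Nat.mul_le_mul_left (2 * k) hAU
      zify at *
      rw [← hcU] at hA'
      have hτ' : (τ : ℤ) = s * k + r - k := by linarith
      rw [hτ'] at hW
      rw [hd] at hcompl
      linarith
  · rw [hsum]
    simp only [Finset.card_univ, Fintype.card_fin, Finset.univ_inter]
    rw [hd]
    linarith

end StarDecomposition

/-! ### Union bound over vertex sets -/

section UnionBound

variable {d τ : ℕ} {t : ℝ}

/-- The probability that a given set of `w` vertices spans at least `τ w` edges. -/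
lemma card_pairing_dense_le {N : ℕ} (hd : 0 < d) (hτ : (2 * τ : ℝ) = t * d) (ht : t < 1)
    (W : Finset (Fin N)) (hW : W.Nonempty) (hWN : (W.card : ℝ) ≤ t * N) :
    ((Finset.univ.filter fun σ : Pairing N d =>
        2 * τ * W.card ≤ innerCount σ.1 (halfEdges d W)).card : ℝ)
      ≤ Fintype.card (Pairing N d) * (Real.exp 2 * (W.card * d)
        * Real.exp (N * (d * rateF (W.card / N) t))) := by
  have hw : 0 < W.card := hW.card_pos
  have hw' : (0 : ℝ) < W.card := by exact_mod_cast hw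
  have hd' : (0 : ℝ) < d := by exact_mod_cast hd
  have hN : 0 < N := hw.trans_le (by simpa using W.card_le_univ)
  have hN' : (0 : ℝ) < N := by exact_mod_cast hN
  have hlt : (W.card : ℝ) < N := by nlinarith
  have hlt' : W.card < N := by exact_mod_cast hlt
  set x : ℝ := W.card / N with hx
  have hcard : ((halfEdges d W).card : ℝ) = x * (N * d : ℕ) := by
    rw [card_halfEdges, hx]; push_cast; field_simp
  have h1 := card_pairing_mul_choose_le (halfEdges d W) (2 * τ * W.card)
    (B := Real.exp ((N * d : ℕ) * (rateF x t + Real.binEntropy x))) fun σ => by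
      have := card_le_exp_rateF σ.1 σ.2 (x := x) (t := t) (by positivity)
        (by rw [hx, div_le_iff₀ hN']; exact hWN) ht (a := (halfEdges d W).card)
        (m := 2 * τ * W.card) (by simpa using hcard) (by
          push_cast
          rw [hτ, hx]
          simp only [Fintype.card_prod, Fintype.card_fin]
          push_cast
          field_simp)
      simpa using this
  have h2 := exp_mul_binEntropy_le_choose (n := N * d) (a := (halfEdges d W).card)
    (by rw [card_halfEdges]; positivity)
    (by rw [card_halfEdges]; exact Nat.mul_lt_mul_of_pos_right hlt' hd)
  have hratio : ((halfEdges d W).card : ℝ) / (N * d : ℕ) = x := by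
    rw [hcard, mul_div_assoc, div_self (by positivity), mul_one]
  rw [hratio] at h2
  have hpos : (0 : ℝ) < ((N * d).choose (halfEdges d W).card : ℕ) := by
    refine Nat.cast_pos.2 (Nat.choose_pos ?_)
    rw [card_halfEdges]; exact Nat.mul_le_mul_right d hlt'.le
  refine le_of_mul_le_mul_right (h1.trans ?_) hpos
  rw [mul_add, Real.exp_add, mul_assoc]
  refine mul_le_mul_of_nonneg_left ?_ (Nat.cast_nonneg _)
  have h3 := mul_le_mul_of_nonneg_left h2 (Real.exp_pos ((N * d : ℕ) * rateF x t)).le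
  refine h3.trans_eq ?_
  rw [card_halfEdges]
  push_cast
  rw [mul_assoc (N : ℝ) d]
  ring

open Classical in
lemma card_pairing_exists_dense_le {N : ℕ} (hd : 0 < d) (hτ : (2 * τ : ℝ) = t * d) (ht : t < 1)
    {w : ℕ} (hw : 0 < w) (hwN : (w : ℝ) ≤ t * N) :
    ((Finset.univ.filter fun σ : Pairing N d => ∃ W : Finset (Fin N), W.card = w ∧
        2 * τ * W.card ≤ innerCount σ.1 (halfEdges d W)).card : ℝ)
      ≤ Fintype.card (Pairing N d) * (Real.exp 2 * d * w * Real.exp (N * rateFd d (w / N) t)) := by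
  have hN' : (0 : ℝ) < N := by
    rcases (Nat.cast_nonneg N : (0 : ℝ) ≤ N).eq_or_lt with h | h
    · rw [← h, mul_zero] at hwN
      have : (0 : ℝ) < w := by exact_mod_cast hw
      linarith
    · exact h
  have hlt : w < N := by
    have : (w : ℝ) < N := by nlinarith
    exact_mod_cast this
  have h1 : (Finset.univ.filter fun σ : Pairing N d => ∃ W : Finset (Fin N), W.card = w ∧
        2 * τ * W.card ≤ innerCount σ.1 (halfEdges d W))
      ⊆ (Finset.univ.powersetCard w).biUnion fun W => Finset.univ.filter fun σ : Pairing N d =>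
        2 * τ * W.card ≤ innerCount σ.1 (halfEdges d W) := by
    intro σ hσ
    obtain ⟨W, hW, h⟩ := (Finset.mem_filter.1 hσ).2
    exact Finset.mem_biUnion.2 ⟨W, by simp [hW], by simpa using h⟩
  calc _ ≤ ((∑ W ∈ Finset.univ.powersetCard w, (Finset.univ.filter fun σ : Pairing N d =>
        2 * τ * W.card ≤ innerCount σ.1 (halfEdges d W)).card : ℕ) : ℝ) :=
        Nat.cast_le.2 ((Finset.card_le_card h1).trans Finset.card_biUnion_le)
    _ ≤ ∑ W ∈ (Finset.univ : Finset (Fin N)).powersetCard w, Fintype.card (Pairing N d) *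
          (Real.exp 2 * (w * d) * Real.exp (N * (d * rateF (w / N) t))) := by
        rw [Nat.cast_sum]
        refine Finset.sum_le_sum fun W hW => ?_
        obtain rfl := (Finset.mem_powersetCard.1 hW).2
        exact card_pairing_dense_le hd hτ ht W (Finset.card_pos.1 hw) hwN
    _ = N.choose w * (Fintype.card (Pairing N d) *
          (Real.exp 2 * (w * d) * Real.exp (N * (d * rateF (w / N) t)))) := by
        simp
    _ ≤ Real.exp (N * Real.binEntropy (w / N)) * (Fintype.card (Pairing N d) *
          (Real.exp 2 * (w * d) * Real.exp (N * (d * rateF (w / N) t)))) := by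
        gcongr
        exact choose_le_exp_mul_binEntropy hw hlt
    _ = _ := by
        rw [rateFd, mul_add, Real.exp_add]
        ring

/-- The term for sets of `w` vertices in the union bound. -/
noncomputable def unionTerm (d : ℕ) (t x₁ : ℝ) (N w : ℕ) : ℝ :=
  if 0 < w ∧ (w : ℝ) ≤ x₁ * N then Real.exp 2 * d * w * Real.exp (N * rateFd d (w / N) t) else 0

lemma unionTerm_nonneg (x₁ : ℝ) (N w : ℕ) : 0 ≤ unionTerm d t x₁ N w := by
  unfold unionTerm
  split_ifs
  · positivity
  · exact le_rfl

/-- Tannery's theorem: each fixed size contributes little because near `0` the rate is at most a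
positive multiple of `x log x` up to `O(x)`, and the contributions are dominated
because the rate is at most `-δ x`. -/
lemma tendsto_tsum_unionTerm {x₁ : ℝ} (ht : t < 1) (hx₁ : 0 < x₁) (hxt : x₁ < t) (hd : 1 ≤ d)
    (hc : 0 ≤ d * t / 2 - 1) (hneg : rateFd d x₁ t < 0) :
    Tendsto (fun N : ℕ => ∑' w, unionTerm d t x₁ N w) atTop (𝓝 0) := by
  obtain ⟨hcpos, δ, hδ, hle⟩ := exists_rateFd_le ht hx₁ hxt hd hc hneg
  obtain ⟨C, hC⟩ := rateFd_le_mul_log (hx₁.trans hxt) ht hd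
  have hsum : Summable fun w : ℕ => Real.exp 2 * d * ((w : ℝ) ^ 1 * Real.exp (-δ * w)) :=
    (Real.summable_pow_mul_exp_neg_nat_mul 1 hδ).mul_left _
  have hzero : (0 : ℝ) = ∑' _ : ℕ, (0 : ℝ) := by simp
  rw [hzero]
  refine tendsto_tsum_of_dominated_convergence hsum (fun w => ?_) ?_
  · rcases Nat.eq_zero_or_pos w with rfl | hw
    · simp [unionTerm]
    have hw' : (0 : ℝ) < w := by exact_mod_cast hw
    have hlim : Tendsto (fun N : ℕ => (w : ℝ) / N) atTop (𝓝[>] 0) := by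
      refine tendsto_nhdsWithin_iff.2 ⟨tendsto_const_div_atTop_nhds_zero_nat _, ?_⟩
      filter_upwards [eventually_gt_atTop 0] with N hN
      have : (0 : ℝ) < N := by exact_mod_cast hN
      exact div_pos hw' this
    have hexp : Tendsto (fun N : ℕ => w * ((d * t / 2 - 1) * Real.log (w / N) + C)) atTop atBot :=
      ((tendsto_atBot_add_const_right _ C
        ((Real.tendsto_log_nhdsGT_zero.comp hlim).const_mul_atBot hcpos))).const_mul_atBot hw'
    have hbound := (Real.tendsto_exp_atBot.comp hexp).const_mul (Real.exp 2 * d * w)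
    rw [mul_zero] at hbound
    refine squeeze_zero' (Eventually.of_forall fun N => unionTerm_nonneg x₁ N w) ?_ hbound
    filter_upwards [eventually_gt_atTop 0] with N hN
    have hN' : (0 : ℝ) < N := by exact_mod_cast hN
    unfold unionTerm
    split_ifs with h
    · simp only [Function.comp_apply]
      refine mul_le_mul_of_nonneg_left (Real.exp_le_exp.2 ?_) (by positivity)
      have h1 := hC (w / N) (by positivity)
        ((div_lt_iff₀ hN').2 (h.2.trans_lt (mul_lt_mul_of_pos_right hxt hN')))
      refine (mul_le_mul_of_nonneg_left h1 hN'.le).trans_eq ?_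
      field_simp
    · simp only [Function.comp_apply]
      positivity
  · filter_upwards [eventually_gt_atTop 0] with N hN w
    have hN' : (0 : ℝ) < N := by exact_mod_cast hN
    rw [Real.norm_of_nonneg (unionTerm_nonneg x₁ N w)]
    unfold unionTerm
    split_ifs with h
    · rw [pow_one, ← mul_assoc]
      refine mul_le_mul_of_nonneg_left (Real.exp_le_exp.2 ?_) (by positivity)
      have h1 := hle (w / N) (by positivity) ((div_le_iff₀ hN').2 h.2)
      refine (mul_le_mul_of_nonneg_left h1 hN'.le).trans_eq ?_
      field_simp
    · positivity

open Classical in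
/-- With probability tending to `1`, no nonempty set of at most `x₁ N` vertices spans `τ` or more
edges per vertex. -/
lemma tendsto_dense_zero {x₁ : ℝ} (hτ : (2 * τ : ℝ) = t * d) (hτ1 : 1 ≤ τ) (ht : t < 1)
    (hx₁ : 0 < x₁) (hxt : x₁ < t) (hneg : rateFd d x₁ t < 0) :
    Tendsto (fun N : ℕ => ((Finset.univ.filter fun σ : Pairing N d =>
        ∃ W : Finset (Fin N), W.Nonempty ∧ (W.card : ℝ) ≤ x₁ * N ∧
          2 * τ * W.card ≤ innerCount σ.1 (halfEdges d W)).card : ℝ) / Fintype.card (Pairing N d))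
      atTop (𝓝 0) := by
  have hτ1' : (1 : ℝ) ≤ τ := by exact_mod_cast hτ1
  have hd : 0 < d := by
    rcases Nat.eq_zero_or_pos d with rfl | h
    · simp at hτ; omega
    · exact h
  refine squeeze_zero (fun N => by positivity) (fun N => ?_)
    (tendsto_tsum_unionTerm ht hx₁ hxt hd (by linarith) hneg)
  have htsum : ∑' w, unionTerm d t x₁ N w = ∑ w ∈ Finset.range (N + 1), unionTerm d t x₁ N w := by
    refine tsum_eq_sum fun w hw => if_neg fun h => ?_
    have h1 : (w : ℝ) ≤ N := by nlinarith [h.2, Nat.cast_nonneg (α := ℝ) N]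
    have h2 : w ≤ N := by exact_mod_cast h1
    exact hw (Finset.mem_range.2 (by omega))
  rw [htsum]
  refine div_le_of_le_mul₀ (Nat.cast_nonneg _)
    (Finset.sum_nonneg fun w _ => unionTerm_nonneg x₁ N w) ?_
  have hsub : (Finset.univ.filter fun σ : Pairing N d =>
        ∃ W : Finset (Fin N), W.Nonempty ∧ (W.card : ℝ) ≤ x₁ * N ∧
          2 * τ * W.card ≤ innerCount σ.1 (halfEdges d W))
      ⊆ ((Finset.range (N + 1)).filter fun w : ℕ => 0 < w ∧ (w : ℝ) ≤ x₁ * N).biUnion fun w =>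
        Finset.univ.filter fun σ : Pairing N d => ∃ W : Finset (Fin N), W.card = w ∧
          2 * τ * W.card ≤ innerCount σ.1 (halfEdges d W) := by
    intro σ hσ
    obtain ⟨W, hW, hle, h⟩ := (Finset.mem_filter.1 hσ).2
    have hWN : W.card ≤ N := by simpa using W.card_le_univ
    exact Finset.mem_biUnion.2 ⟨W.card, Finset.mem_filter.2
      ⟨Finset.mem_range.2 (by omega), hW.card_pos, hle⟩,
      Finset.mem_filter.2 ⟨Finset.mem_univ _, W, rfl, h⟩⟩
  refine (Nat.cast_le.2 ((Finset.card_le_card hsub).trans Finset.card_biUnion_le)).trans ?_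
  rw [Nat.cast_sum, Finset.sum_filter, Finset.sum_mul]
  simp_rw [mul_comm (unionTerm d t x₁ N _)]
  refine Finset.sum_le_sum fun w _ => ?_
  unfold unionTerm
  split_ifs with h
  · exact card_pairing_exists_dense_le hd hτ ht h.1
      (h.2.trans (mul_le_mul_of_nonneg_right hxt.le (Nat.cast_nonneg N)))
  · simp

end UnionBound

/-! ### Star decompositions of the configuration model -/

theorem theorem4p1 (d k s r : ℕ) (hk : 2 ≤ k) (hs : 1 ≤ s)
    (hd : d = 2 * s * k + r) (hr : r < 2 * k)
    (hstrong : rateFd d ((r : ℝ) / (2 * k)) (((d : ℝ) - 2 * k + r) / d) < 0) :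
    Tendsto
      (fun N : ℕ => configProb N d fun G =>
        ∀ A₀ A₁ : Finset (Fin N), Disjoint A₀ A₁ → A₀ ∪ A₁ = Finset.univ →
          (A₁.card : ℝ) = (r : ℝ) * N / (2 * k) →
          HasStarDecomposition G k (fun v => if v ∈ A₁ then s + 1 else s))
      (atTop ⊓ 𝓟 {N : ℕ | 2 * k ∣ N * d}) (𝓝 1) := by
  classical
  have hr0 : 0 < r := by
    rcases Nat.eq_zero_or_pos r with rfl | h
    · simp [rateFd_zero] at hstrong
    · exact h
  have hk' : (2 : ℝ) ≤ k := by exact_mod_cast hk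
  have hs' : (1 : ℝ) ≤ s := by exact_mod_cast hs
  have hr0' : (0 : ℝ) < r := by exact_mod_cast hr0
  have hr' : (r : ℝ) < 2 * k := by exact_mod_cast hr
  have hd' : (d : ℝ) = 2 * s * k + r := by exact_mod_cast hd
  have hsk : (k : ℝ) ≤ s * k := by nlinarith
  have hdpos : (0 : ℝ) < d := by linarith
  obtain ⟨τ, hτ⟩ : ∃ τ, τ + k = s * k + r :=
    Nat.exists_eq_add_of_le' (by nlinarith : k ≤ s * k + r) |>.imp fun _ h => h.symm
  have hτ' : (τ : ℝ) + k = s * k + r := by exact_mod_cast hτ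
  set x₀ : ℝ := r / (2 * k) with hx₀
  set t₀ : ℝ := (d - 2 * k + r) / d with ht₀
  have hx₀pos : 0 < x₀ := by positivity
  have hx₀1 : x₀ < 1 := by rw [hx₀, div_lt_one (by linarith)]; exact hr'
  have hxk : x₀ * (2 * k) = r := by rw [hx₀]; field_simp
  have htd : t₀ * d = d - 2 * k + r := by rw [ht₀]; field_simp
  have ht₀1 : t₀ < 1 := by rw [ht₀, div_lt_one hdpos]; linarith
  -- The fractions of split half-edges at the two thresholds, `1 - t₀ = (2k - r) / d` and
  -- `1 - t₁ = r / d`, are smaller than `1 - x₀ = (2k - r) / 2k` and `x₀ = r / 2k`, as `d > 2k`.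
  have hxt₀ : x₀ < t₀ := by
    have : (1 - t₀) * d < (1 - x₀) * d := by nlinarith
    linarith [lt_of_mul_lt_mul_right this hdpos.le]
  set t₁ : ℝ := 2 * (s * k) / d with ht₁
  have ht₁d : t₁ * d = 2 * (s * k) := by rw [ht₁]; field_simp
  have ht₁1 : t₁ < 1 := by rw [ht₁, div_lt_one hdpos]; linarith
  have hxt₁ : 1 - x₀ < t₁ := by
    have : (1 - t₁) * d < x₀ * d := by nlinarith
    linarith [lt_of_mul_lt_mul_right this hdpos.le]
  have hneg₁ : rateFd d (1 - x₀) t₁ < 0 := by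
    rwa [rateFd_compl (x := x₀) (t := t₀) rfl]
    refine mul_right_cancel₀ hdpos.ne' ?_
    linear_combination (x₀ - 1) * ht₁d + x₀ * htd + (1 - x₀) * hd' - hxk
  have hτ1 : 1 ≤ τ := by nlinarith
  have h₀ := tendsto_dense_zero (τ := τ) (t := t₀) (by linarith) hτ1 ht₀1 hx₀pos hxt₀ hstrong
  have h₁ := tendsto_dense_zero (τ := s * k) (t := t₁) (x₁ := 1 - x₀) (by push_cast; linarith)
    (by nlinarith) ht₁1 (by linarith) hxt₁ hneg₁
  have hlim := (((h₀.add h₁).const_sub 1).mono_left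
    (inf_le_left : atTop ⊓ 𝓟 {N : ℕ | 2 * k ∣ N * d} ≤ atTop))
  simp only [add_zero, sub_zero] at hlim
  refine tendsto_of_tendsto_of_tendsto_of_le_of_le' hlim tendsto_const_nhds ?_ ?_
  · filter_upwards [mem_inf_of_right (mem_principal_self _)] with N hN
    have hne : Nonempty (Pairing N d) := nonempty_pairing ((Dvd.intro _ rfl).trans hN)
    have hpos : (0 : ℝ) < Fintype.card (Pairing N d) := by exact_mod_cast Fintype.card_pos
    rw [configProb, Nat.card_eq_fintype_card, Nat.card_eq_fintype_card, Fintype.card_subtype,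
      ← add_div, le_div_iff₀ hpos, sub_mul, div_mul_cancel₀ _ hpos.ne', one_mul, sub_le_iff_le_add,
      ← Nat.cast_add, ← Nat.cast_add, Nat.cast_le, ← Finset.card_univ]
    refine (Finset.card_le_card fun σ _ => ?_).trans ((Finset.card_union_le _ _).trans
      (Nat.add_le_add_left (Finset.card_union_le _ _) _))
    by_contra hσ
    simp only [Finset.mem_union, Finset.mem_filter, Finset.mem_univ, true_and, not_or] at hσ
    obtain ⟨hσ, hσ₀, hσ₁⟩ := hσ
    push Not at hσ₀ hσ₁
    exact hσ fun _ A₁ _ _ hA =>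
      hasStarDecomposition_of_sparse (by omega) hd hτ σ hσ₀ hσ₁ A₁ hA
  · refine Eventually.of_forall fun N => div_le_one_of_le₀ ?_ (Nat.cast_nonneg _)
    exact_mod_cast Finite.card_subtype_le _
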